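/- For integers $n,k,g,\lambda$, an $egr(n,k,g,\lambda)$ graph is a finite simple $k$-regular graph of order $n$ and girth $g$ such that every edge is contained in exactly $\lambda$ distinct cycles of length $g$. Let $q$ be a prime power. Then there exists a generalized quadrangle of order $(q,q)$, and there exists an $$egr\bigl(2q^3,\;q,\;8,\;(q-1)^2\bigl((q-2)^2+1\bigr)\bigr)$$ graph. More precisely, let $F$ be a field with $q$ elements and let $W(q)$ be the symplectic quadrangle over $F$: its points are the points of $PG(3,q)$, its lines are the lines of $PG(3,q)$ that are totally isotropic for the alternating form $x_0y_1-x_1y_0+x_2y_3-x_3y_2$, and incidence is containment. Then $W(q)$ is a generalized quadrangle of order $(q,q)$, and for every point $P$ and every line $e_0$ of $W(q)$ incident with $P$, the incidence graph of the geometry obtained from $W(q)$ by deleting all points on the lines through $P$ (including $P$) and all lines incident with a point of $e_0$ (including $e_0$) is an $egr\bigl(2q^3,q,8,(q-1)^2((q-2)^2+1)\bigr)$ graph. -/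

import Mathlib

/-- The point-line geometry with incidence relation `I` is a (finite) generalized quadrangle of
order `(s, t)`. -/
structure IsGeneralizedQuadrangle {α β : Type*} (I : α → β → Prop) (s t : ℕ) : Prop where
  nonempty_points : Nonempty α
  nonempty_lines : Nonempty β
  one_le_s : 1 ≤ s
  one_le_t : 1 ≤ t
  /-- Every point is incident with exactly `t + 1` lines. -/
  card_lines : ∀ x : α, {L : β | I x L}.ncard = t + 1
  /-- Every line is incident with exactly `s + 1` points. -/
  card_points : ∀ L : β, {x : α | I x L}.ncard = s + 1
  /-- Two distinct points are incident with at most one common line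
  (equivalently, two distinct lines are incident with at most one common point). -/
  eq_or_eq : ∀ (x y : α) (L M : β), I x L → I y L → I x M → I y M → x = y ∨ L = M
  /-- For a non-incident point-line pair `(x, L)` there is a unique pair `(y, M)` with
  `x I M I y I L`. -/
  existsUnique_proj : ∀ (x : α) (L : β), ¬ I x L → ∃! p : α × β, I x p.2 ∧ I p.1 p.2 ∧ I p.1 L

/-- The incidence graph (Levi graph) of a point-line geometry. -/
def incidenceGraph {α β : Type*} (I : α → β → Prop) : SimpleGraph (α ⊕ β) where
  Adj
    | .inl x, .inr L => I x L
    | .inr L, .inl x => I x L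
    | _, _ => False
  symm := ⟨by rintro (x | L) (y | M) h <;> exact h⟩
  loopless := ⟨by rintro (x | L) h <;> exact h⟩

/-- The incidence graph of the geometry obtained from `I` by deleting all points lying on some line
through the point `P` (so also `P` itself) and all lines incident with some point of the line `e`
(so also `e` itself, when it has a point). -/
def deletedIncidenceGraph {α β : Type*} (I : α → β → Prop) (P : α) (e : β) :
    SimpleGraph ({x : α // ¬ ∃ L, I P L ∧ I x L} ⊕ {M : β // ¬ ∃ y, I y e ∧ I y M}) :=
  incidenceGraph fun x M => I x.1 M.1

/-- The subgraph `H` of `G` is a cycle of length `g`. -/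
def IsCycleSubgraph {V : Type*} (G : SimpleGraph V) (g : ℕ) (H : G.Subgraph) : Prop :=
  ∃ (v : V) (c : G.Walk v v), c.IsCycle ∧ c.length = g ∧ c.toSubgraph = H

/-- `G` is an edge-girth-regular graph `egr(n, k, g, l)`: a finite `k`-regular graph of order `n`
and girth `g`, every edge of which lies in exactly `l` distinct cycles of length `g`. -/
structure IsEdgeGirthRegular {V : Type*} (G : SimpleGraph V) (n k g l : ℕ) : Prop where
  finite : Finite V
  order : Nat.card V = n
  regular : ∀ v : V, (G.neighborSet v).ncard = k
  girth : G.egirth = g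
  cycles : ∀ e ∈ G.edgeSet, {H : G.Subgraph | IsCycleSubgraph G g H ∧ e ∈ H.edgeSet}.ncard = l

/-- The standard symplectic (nondegenerate alternating) form on `F⁴`. -/
def symplecticForm {F : Type*} [Field F] (x y : Fin 4 → F) : F :=
  x 0 * y 1 - x 1 * y 0 + x 2 * y 3 - x 3 * y 2

/-- The lines of the symplectic quadrangle `W(F)`: the lines of `PG(3, F)`, that is, the
2-dimensional subspaces of `F⁴`, which are totally isotropic. -/
def SymplecticLine (F : Type*) [Field F] : Type _ :=
  {L : Submodule F (Fin 4 → F) //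
    Module.finrank F L = 2 ∧ ∀ x ∈ L, ∀ y ∈ L, symplecticForm x y = 0}

/-- The incidence relation of the symplectic quadrangle `W(F)`, whose points are all the points of
`PG(3, F)`. -/
def symplecticIncidence (F : Type*) [Field F]
    (P : Projectivization F (Fin 4 → F)) (L : SymplecticLine F) : Prop :=
  P.submodule ≤ L.1

/-! Everything after the construction of W(q) uses only the quadrangle axioms. Call a point far if
it is not collinear with P, and a line far if it does not meet e; the deleted graph is the incidence
graph of far points and far lines. A far point is off e, and exactly one line through it meets e, so
t of its t + 1 lines survive; duality handles lines. A quadrangle has no digons or triangles, so the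
girth is at least 8. Cycles of length 8 through an edge xL correspond to paths L y M z N w K x.
Choose K through x and y on L in (t - 1)(s - 1) ways, then w on K and M through y in (s - 1)(t - 1)
ways. As w is off M, the axiom determines z and N. A completion fails when z is near P (t - 2 pairs,
`ncard_near_point_quadrilaterals`) or N meets e (s - 2 pairs, the dual count), and never for both
reasons. With s = t = q this leaves (q - 1)² - 2(q - 2) = (q - 2)² + 1 completions
(`ncard_far_quadrilaterals`). This number is positive, so the girth is exactly 8. -/

/-- The standard symplectic form as a bilinear form. -/
def symplecticBilin (F : Type*) [Field F] : LinearMap.BilinForm F (Fin 4 → F) :=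
  LinearMap.mk₂ F symplecticForm
    (by intros; simp [symplecticForm]; ring) (by intros; simp [symplecticForm]; ring)
    (by intros; simp [symplecticForm]; ring) (by intros; simp [symplecticForm]; ring)

/-! ### The symplectic quadrangle W(F). -/

section Symplectic

variable {F : Type*} [Field F]

@[simp] lemma symplecticBilin_apply (x y : Fin 4 → F) :
    symplecticBilin F x y = symplecticForm x y := rfl

lemma symplecticForm_self (x : Fin 4 → F) : symplecticForm x x = 0 := by
  simp [symplecticForm]; ring

lemma symplecticForm_swap (x y : Fin 4 → F) : symplecticForm x y = - symplecticForm y x := by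
  simp [symplecticForm]; ring

lemma symplecticForm_add_right (x y z : Fin 4 → F) :
    symplecticForm x (y + z) = symplecticForm x y + symplecticForm x z :=
  (symplecticBilin F x).map_add y z

lemma symplecticForm_smul_right (a : F) (x y : Fin 4 → F) :
    symplecticForm x (a • y) = a * symplecticForm x y :=
  (symplecticBilin F x).map_smul a y

lemma symplecticForm_sub_right (x y z : Fin 4 → F) :
    symplecticForm x (y - z) = symplecticForm x y - symplecticForm x z :=
  (symplecticBilin F x).map_sub y z

lemma exists_symplecticForm_ne_zero {v : Fin 4 → F} (hv : v ≠ 0) :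
    ∃ y, symplecticForm v y ≠ 0 := by
  by_contra! h
  apply hv
  have h0 := h ![1, 0, 0, 0]
  have h1 := h ![0, 1, 0, 0]
  have h2 := h ![0, 0, 1, 0]
  have h3 := h ![0, 0, 0, 1]
  simp [symplecticForm] at h0 h1 h2 h3
  ext i
  fin_cases i <;> simp [*]

lemma symplecticBilin_nondegenerate : (symplecticBilin F).Nondegenerate := by
  constructor
  · intro v hv
    by_contra h
    obtain ⟨y, hy⟩ := exists_symplecticForm_ne_zero h
    exact hy (hv y)
  · intro v hv
    by_contra h
    obtain ⟨y, hy⟩ := exists_symplecticForm_ne_zero h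
    rw [symplecticForm_swap] at hy
    exact hy (by simpa using hv y)

lemma finrank_span_pair {u v : Fin 4 → F} (h : LinearIndependent F ![u, v]) :
    Module.finrank F (Submodule.span F {u, v}) = 2 := by
  have hr : Set.range ![u, v] = {u, v} := by
    simp [Matrix.range_cons, Matrix.range_empty, Set.pair_comm]
  rw [← hr, finrank_span_eq_card h, Fintype.card_fin]

lemma eq_span_pair {L : Submodule F (Fin 4 → F)} (hL : Module.finrank F L = 2)
    {u v : Fin 4 → F} (hu : u ∈ L) (hv : v ∈ L) (h : LinearIndependent F ![u, v]) :
    L = Submodule.span F {u, v} := by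
  symm
  apply Submodule.eq_of_le_of_finrank_eq
  · rw [Submodule.span_le]
    rintro _ (rfl | rfl) <;> assumption
  · rw [finrank_span_pair h, hL]

lemma submodule_le_iff_rep_mem (P : Projectivization F (Fin 4 → F))
    (L : Submodule F (Fin 4 → F)) : P.submodule ≤ L ↔ P.rep ∈ L := by
  rw [P.submodule_eq, Submodule.span_singleton_le_iff_mem]

lemma submodule_mk_le_iff {v : Fin 4 → F} (hv : v ≠ 0) (L : Submodule F (Fin 4 → F)) :
    (Projectivization.mk F v hv).submodule ≤ L ↔ v ∈ L := by
  rw [Projectivization.submodule_mk, Submodule.span_singleton_le_iff_mem]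

lemma symplecticIncidence_iff (P : Projectivization F (Fin 4 → F)) (L : SymplecticLine F) :
    symplecticIncidence F P L ↔ P.rep ∈ L.1 :=
  submodule_le_iff_rep_mem P L.1

lemma symplecticIncidence_mk_iff {v : Fin 4 → F} (hv : v ≠ 0) (L : SymplecticLine F) :
    symplecticIncidence F (.mk F v hv) L ↔ v ∈ L.1 :=
  submodule_mk_le_iff hv L.1

lemma ncard_points_le [Finite F] {L : Submodule F (Fin 4 → F)} (hL : Module.finrank F L = 2) :
    {P : Projectivization F (Fin 4 → F) | P.submodule ≤ L}.ncard = Nat.card F + 1 := by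
  rw [← Projectivization.card_of_finrank_two F L hL, ← Set.ncard_univ,
    ← Set.ncard_image_of_injective Set.univ
      (Projectivization.map_injective L.subtype L.injective_subtype)]
  congr 1
  ext P
  constructor
  · intro h
    rw [Set.mem_ofPred_eq, submodule_le_iff_rep_mem] at h
    refine ⟨.mk F ⟨P.rep, h⟩ (by simpa [Subtype.ext_iff] using P.rep_nonzero), trivial, ?_⟩
    rw [Projectivization.map_mk]
    exact P.mk_rep
  · rintro ⟨Q, -, rfl⟩
    induction Q using Projectivization.ind with
    | h v hv =>
      rw [Projectivization.map_mk, Set.mem_ofPred_eq, submodule_mk_le_iff]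
      exact v.2

/-- Pairing with y is a nonzero functional on the plane L, so its kernel there is a line, and b lies
outside it. -/
lemma exists_mem_symplecticForm_eq_zero {L : Submodule F (Fin 4 → F)}
    (hL : Module.finrank F L = 2) {b y : Fin 4 → F} (hb : b ∈ L) (hby : symplecticForm y b ≠ 0) :
    ∃ u ∈ L, symplecticForm y u = 0 ∧ LinearIndependent F ![b, u] := by
  have hb0 : b ≠ 0 := by rintro rfl; simp [symplecticForm] at hby
  obtain ⟨c, hc, hcb⟩ : ∃ c ∈ L, c ∉ Submodule.span F {b} := by
    by_contra! h
    have := Submodule.finrank_mono (show L ≤ Submodule.span F {b} from h)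
    rw [hL, finrank_span_singleton hb0] at this
    omega
  -- Correct c by the multiple of b that cancels its pairing with y.
  refine ⟨c - (symplecticForm y c / symplecticForm y b) • b,
    L.sub_mem hc (L.smul_mem _ hb), ?_, ?_⟩
  · rw [symplecticForm_sub_right, symplecticForm_smul_right]
    field_simp
    simp
  · rw [LinearIndependent.pair_iff' hb0]
    intro a ha
    apply hcb
    rw [Submodule.mem_span_singleton]
    exact ⟨a + symplecticForm y c / symplecticForm y b, by rw [add_smul, ha]; abel⟩

/-- The totally isotropic line spanned by two orthogonal vectors. -/
def SymplecticLine.ofPair (u v : Fin 4 → F) (h : LinearIndependent F ![u, v])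
    (huv : symplecticForm u v = 0) : SymplecticLine F :=
  ⟨Submodule.span F {u, v}, finrank_span_pair h, by
    intro x hx y hy
    obtain ⟨a, b, rfl⟩ := Submodule.mem_span_pair.1 hx
    obtain ⟨c, d, rfl⟩ := Submodule.mem_span_pair.1 hy
    have hvu : symplecticForm v u = 0 := by rw [symplecticForm_swap, huv, neg_zero]
    rw [symplecticForm_add_right, symplecticForm_smul_right, symplecticForm_smul_right,
      symplecticForm_swap, symplecticForm_swap _ v]
    simp [symplecticForm_add_right, symplecticForm_smul_right, huv, hvu, symplecticForm_self]⟩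

lemma SymplecticLine.eq_ofPair (L : SymplecticLine F) {u v : Fin 4 → F}
    (h : LinearIndependent F ![u, v]) (huv : symplecticForm u v = 0) (hu : u ∈ L.1)
    (hv : v ∈ L.1) : L = .ofPair u v h huv :=
  Subtype.ext (eq_span_pair L.2.1 hu hv h)

/-- A totally isotropic L lies in its orthogonal complement, and both have dimension 2 in F⁴, so
they coincide. -/
lemma SymplecticLine.mem_of_forall_symplecticForm_eq_zero (L : SymplecticLine F)
    {v : Fin 4 → F} (h : ∀ b ∈ L.1, symplecticForm v b = 0) : v ∈ L.1 := by
  have h1 : L.1 ≤ (symplecticBilin F).orthogonal L.1 := fun x hx y hy => L.2.2 y hy x hx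
  have h2 := LinearMap.BilinForm.finrank_orthogonal (symplecticBilin_nondegenerate (F := F)) L.1
  have h3 := Submodule.eq_of_le_of_finrank_eq h1 (by rw [h2, L.2.1]; simp)
  rw [h3]
  intro y hy
  show symplecticForm y v = 0
  rw [symplecticForm_swap, h y hy, neg_zero]

lemma mk_eq_mk_of_eq_smul {u v : Fin 4 → F} (hu : u ≠ 0) (hv : v ≠ 0) {a : F} (h : u = a • v) :
    Projectivization.mk F u hu = .mk F v hv :=
  (Projectivization.mk_eq_mk_iff' F u v hu hv).2 ⟨a, h.symm⟩

/-- For y not orthogonal to x, x^⊥ is the direct sum of ⟨x⟩ and W = {x, y}^⊥. So each isotropic line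
through x meets the projective line W in exactly one point, and every point of W arises. -/
lemma ncard_lines_through [Finite F] (x : Projectivization F (Fin 4 → F)) :
    {L : SymplecticLine F | symplecticIncidence F x L}.ncard = Nat.card F + 1 := by
  obtain ⟨y, hy⟩ := exists_symplecticForm_ne_zero x.rep_nonzero
  have hy' : symplecticForm y x.rep ≠ 0 := by
    rw [symplecticForm_swap]; simpa using hy
  have hind : LinearIndependent F ![x.rep, y] := by
    rw [LinearIndependent.pair_iff' x.rep_nonzero]
    rintro a rfl
    rw [symplecticForm_smul_right, symplecticForm_self, mul_zero] at hy
    exact hy rfl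
  let W := (symplecticBilin F).orthogonal (Submodule.span F {x.rep, y})
  have hW : Module.finrank F W = 2 := by
    rw [LinearMap.BilinForm.finrank_orthogonal (symplecticBilin_nondegenerate (F := F)),
      finrank_span_pair hind]
    simp
  have memW : ∀ z, z ∈ W ↔ symplecticForm x.rep z = 0 ∧ symplecticForm y z = 0 := by
    intro z
    constructor
    · intro h
      exact ⟨h _ (Submodule.subset_span (by simp)), h _ (Submodule.subset_span (by simp))⟩
    · rintro ⟨h1, h2⟩ w hw
      obtain ⟨a, b, rfl⟩ := Submodule.mem_span_pair.1 hw
      show symplecticForm _ z = 0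
      rw [symplecticForm_swap, symplecticForm_add_right, symplecticForm_smul_right,
        symplecticForm_smul_right, symplecticForm_swap z, symplecticForm_swap z, h1, h2]
      simp
  have hxW : ∀ P : Projectivization F (Fin 4 → F), P.submodule ≤ W →
      LinearIndependent F ![x.rep, P.rep] := by
    intro P hP
    rw [submodule_le_iff_rep_mem, memW] at hP
    rw [LinearIndependent.pair_iff' x.rep_nonzero]
    intro a ha
    have hP2 := hP.2
    rw [← ha, symplecticForm_smul_right] at hP2
    rcases mul_eq_zero.1 hP2 with h | h
    · rw [h, zero_smul] at ha
      exact P.rep_nonzero ha.symm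
    · exact hy' h
  rw [← ncard_points_le hW]
  symm
  refine Set.ncard_congr (fun P hP => SymplecticLine.ofPair x.rep P.rep (hxW P hP)
    ((memW _).1 ((submodule_le_iff_rep_mem P W).1 hP)).1) ?_ ?_ ?_
  · intro P hP
    exact (symplecticIncidence_iff _ _).2 (Submodule.subset_span (by simp))
  · intro P Q hP hQ h
    have hmem : P.rep ∈ Submodule.span F {x.rep, Q.rep} := by
      have := congrArg Subtype.val h
      simp only [SymplecticLine.ofPair] at this
      rw [← this]
      exact Submodule.subset_span (by simp)
    obtain ⟨a, b, hab⟩ := Submodule.mem_span_pair.1 hmem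
    have hP' := (memW _).1 ((submodule_le_iff_rep_mem P W).1 hP)
    have hQ' := (memW _).1 ((submodule_le_iff_rep_mem Q W).1 hQ)
    -- Pairing with y kills both points of W but not x, which isolates the coefficient a.
    have ha : a = 0 := by
      have := hP'.2
      rw [← hab, symplecticForm_add_right, symplecticForm_smul_right, symplecticForm_smul_right,
        hQ'.2] at this
      simpa [hy'] using this
    rw [ha, zero_smul, zero_add] at hab
    rw [← P.mk_rep, ← Q.mk_rep]
    exact mk_eq_mk_of_eq_smul _ _ hab.symm
  · intro L hL
    have hx := (symplecticIncidence_iff _ _).1 hL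
    obtain ⟨u, hu, hyu, hxu⟩ := exists_mem_symplecticForm_eq_zero L.2.1 hx hy'
    have hu0 : u ≠ 0 := hxu.ne_zero 1
    have hPW : (Projectivization.mk F u hu0).submodule ≤ W :=
      (submodule_mk_le_iff hu0 W).2 ((memW u).2 ⟨L.2.2 _ hx _ hu, hyu⟩)
    refine ⟨.mk F u hu0, hPW, ?_⟩
    symm
    apply SymplecticLine.eq_ofPair _ _ _ hx
    rw [← submodule_le_iff_rep_mem, submodule_mk_le_iff]
    exact hu

/-- For x off L, pairing with x does not vanish on L, since L is its own orthogonal complement. Its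
kernel on L is the unique point of L collinear with x. -/
theorem isGeneralizedQuadrangle_symplecticIncidence (F : Type*) [Field F] [Finite F] :
    IsGeneralizedQuadrangle (symplecticIncidence F) (Nat.card F) (Nat.card F) where
  nonempty_points := inferInstance
  nonempty_lines := by
    obtain ⟨x⟩ : Nonempty (Projectivization F (Fin 4 → F)) := inferInstance
    obtain ⟨L, -⟩ := Set.nonempty_of_ncard_ne_zero
      (by rw [ncard_lines_through x]; omega :
        {L : SymplecticLine F | symplecticIncidence F x L}.ncard ≠ 0)
    exact ⟨L⟩
  one_le_s := Nat.card_pos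
  one_le_t := Nat.card_pos
  card_lines := ncard_lines_through
  card_points L := ncard_points_le L.2.1
  eq_or_eq x y L M hxL hyL hxM hyM := by
    rw [or_iff_not_imp_left]
    intro h
    rw [symplecticIncidence_iff] at *
    have hind := Projectivization.linearIndependent_pair_iff_ne.2 h
    have hL := L.eq_ofPair hind (L.2.2 _ hxL _ hyL) hxL hyL
    have hM := M.eq_ofPair hind (L.2.2 _ hxL _ hyL) hxM hyM
    rw [hL, hM]
  existsUnique_proj x L hxL := by
    rw [symplecticIncidence_iff] at hxL
    obtain ⟨b, hb, hxb⟩ : ∃ b ∈ L.1, symplecticForm x.rep b ≠ 0 := by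
      by_contra! h
      exact hxL (L.mem_of_forall_symplecticForm_eq_zero h)
    obtain ⟨u, hu, hxu, hbu⟩ := exists_mem_symplecticForm_eq_zero L.2.1 hb hxb
    have hu0 : u ≠ 0 := hbu.ne_zero 1
    have hind : LinearIndependent F ![x.rep, u] := by
      rw [LinearIndependent.pair_iff' x.rep_nonzero]
      rintro a rfl
      have ha : a ≠ 0 := by rintro rfl; simp at hu0
      exact hxL ((L.1.smul_mem_iff ha).1 hu)
    refine ⟨(.mk F u hu0, .ofPair _ _ hind hxu), ⟨?_, ?_, ?_⟩, ?_⟩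
    · exact (symplecticIncidence_iff _ _).2 (Submodule.subset_span (by simp))
    · exact (symplecticIncidence_mk_iff _ _).2 (Submodule.subset_span (by simp))
    · exact (symplecticIncidence_mk_iff _ _).2 hu
    · rintro ⟨Q, M⟩ ⟨h1, h2, h3⟩
      dsimp only at h1 h2 h3
      rw [symplecticIncidence_iff] at h1 h2 h3
      have hQ : Q = .mk F u hu0 := by
        have := h3
        rw [eq_span_pair L.2.1 hb hu hbu] at this
        obtain ⟨c, d, hcd⟩ := Submodule.mem_span_pair.1 this
        have hxQ := M.2.2 _ h1 _ h2
        rw [← hcd, symplecticForm_add_right, symplecticForm_smul_right, symplecticForm_smul_right,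
          hxu] at hxQ
        have hc : c = 0 := by simpa [hxb] using hxQ
        rw [hc, zero_smul, zero_add] at hcd
        rw [← Q.mk_rep]
        exact mk_eq_mk_of_eq_smul _ _ hcd.symm
      refine Prod.ext hQ (M.eq_ofPair hind hxu h1 ?_)
      rw [← submodule_mk_le_iff hu0, ← hQ, submodule_le_iff_rep_mem]
      exact h2

instance [Finite F] : Finite (SymplecticLine F) :=
  Finite.of_injective (fun L => (L.1 : Set (Fin 4 → F)))
    (SetLike.coe_injective.comp Subtype.val_injective)

end Symplectic

/-! ### Counting far points, far lines and far quadrilaterals. -/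

/-- The point `x` is not collinear with `P`. Applied to `flip I`: two lines do not meet. -/
def IsFar {α β : Type*} (I : α → β → Prop) (P x : α) : Prop := ¬ ∃ L, I P L ∧ I x L

namespace IsGeneralizedQuadrangle

variable {α β : Type*} {I : α → β → Prop} {s t : ℕ}

theorem dual (h : IsGeneralizedQuadrangle I s t) : IsGeneralizedQuadrangle (flip I) t s where
  nonempty_points := h.nonempty_lines
  nonempty_lines := h.nonempty_points
  one_le_s := h.one_le_t
  one_le_t := h.one_le_s
  card_lines := h.card_points
  card_points := h.card_lines
  eq_or_eq L M x y h1 h2 h3 h4 := (h.eq_or_eq x y L M h1 h3 h2 h4).symm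
  existsUnique_proj L x hx := by
    obtain ⟨⟨y, M⟩, ⟨h1, h2, h3⟩, hu⟩ := h.existsUnique_proj x L hx
    refine ⟨(M, y), ⟨h3, h2, h1⟩, ?_⟩
    rintro ⟨N, z⟩ ⟨h4, h5, h6⟩
    have := hu (z, N) ⟨h6, h5, h4⟩
    simp only [Prod.mk.injEq] at this ⊢
    exact this.symm

theorem exists_proj (h : IsGeneralizedQuadrangle I s t) {x : α} {L : β} (hx : ¬ I x L) :
    ∃ y M, I x M ∧ I y M ∧ I y L := by
  obtain ⟨⟨y, M⟩, hp, -⟩ := h.existsUnique_proj x L hx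
  exact ⟨y, M, hp⟩

theorem proj_unique (h : IsGeneralizedQuadrangle I s t) {x y z : α} {L M N : β} (hx : ¬ I x L)
    (hxM : I x M) (hyM : I y M) (hyL : I y L) (hxN : I x N) (hzN : I z N) (hzL : I z L) :
    y = z ∧ M = N := by
  have := (h.existsUnique_proj x L hx).unique (y₁ := (y, M)) (y₂ := (z, N))
    ⟨hxM, hyM, hyL⟩ ⟨hxN, hzN, hzL⟩
  simpa using this

theorem ncard_lines_ne (h : IsGeneralizedQuadrangle I s t) {x : α} {N : β} (hN : I x N) :
    {M | I x M ∧ M ≠ N}.ncard = t := by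
  rw [show {M | I x M ∧ M ≠ N} = {M | I x M} \ {N} from rfl,
    Set.ncard_sdiff_singleton_of_mem (show N ∈ {M | I x M} from hN), h.card_lines]
  rfl

theorem ncard_points_ne (h : IsGeneralizedQuadrangle I s t) {y : α} {L : β} (hy : I y L) :
    {x | I x L ∧ x ≠ y}.ncard = s :=
  h.dual.ncard_lines_ne hy

theorem ncard_far_lines_through (h : IsGeneralizedQuadrangle I s t) {P x : α} {e : β}
    (hP : I P e) (hx : IsFar I P x) : {M | I x M ∧ IsFar (flip I) e M}.ncard = t := by
  have hxe : ¬ I x e := fun hxe => hx ⟨e, hP, hxe⟩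
  obtain ⟨y, N, h1, h2, h3⟩ := h.exists_proj hxe
  have : {M | I x M ∧ IsFar (flip I) e M} = {M | I x M ∧ M ≠ N} := by
    ext M
    constructor
    · rintro ⟨h4, h5⟩
      refine ⟨h4, ?_⟩
      rintro rfl
      exact h5 ⟨y, h3, h2⟩
    · rintro ⟨h4, h5⟩
      refine ⟨h4, ?_⟩
      rintro ⟨z, h6, h7⟩
      exact h5 (h.proj_unique hxe h4 h7 h6 h1 h2 h3).2
  rw [this, h.ncard_lines_ne h1]

theorem ncard_far_points_on (h : IsGeneralizedQuadrangle I s t) {P : α} {e L : β}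
    (hP : I P e) (hL : IsFar (flip I) e L) : {x | I x L ∧ IsFar I P x}.ncard = s :=
  h.dual.ncard_far_lines_through hP hL

/-- A far point x corresponds to the chain y, M, x in which y ≠ P is its projection to e and M ≠ e
is the joining line: s, t and s choices. -/
theorem card_far [Finite α] [Finite β] (h : IsGeneralizedQuadrangle I s t) {P : α} {e : β}
    (hP : I P e) : Nat.card {x // IsFar I P x} = s * (t * s) := by
  let A := {y // I y e ∧ y ≠ P}
  let B (y : A) := {M // I y.1 M ∧ M ≠ e}
  let C (y : A) (M : B y) := {x // I x M.1 ∧ x ≠ y.1}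
  have hA : Nat.card A = s := h.ncard_points_ne hP
  have hB (y : A) : Nat.card (B y) = t := h.ncard_lines_ne y.2.1
  have hC (y : A) (M : B y) : Nat.card (C y M) = s := h.ncard_points_ne M.2.1
  have key : Nat.card (Σ y : A, Σ M : B y, C y M) = s * (t * s) := by
    classical
    have := Fintype.ofFinite A
    have (y : A) := Fintype.ofFinite (B y)
    simp only [Nat.card_sigma, hC, Finset.sum_const, Finset.card_univ, smul_eq_mul,
      ← Nat.card_eq_fintype_card, hB, hA]
  rw [← key]
  symm
  have hxe (p : Σ y : A, Σ M : B y, C y M) : ¬ I p.2.2.1 e := fun hxe => by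
    rcases h.eq_or_eq _ _ _ _ p.2.2.2.1 p.2.1.2.1 hxe p.1.2.1 with h1 | h1
    exacts [p.2.2.2.2 h1, p.2.1.2.2 h1]
  refine Nat.card_eq_of_bijective (fun p => ⟨p.2.2.1, ?_⟩) ⟨?_, ?_⟩
  · rintro ⟨N, hPN, hxN⟩
    exact p.1.2.2 (h.proj_unique (hxe p) p.2.2.2.1 p.2.1.2.1 p.1.2.1 hxN hPN hP).1
  · intro p p' hpp
    have hxe' := hxe p
    obtain ⟨⟨y, hy, _⟩, ⟨M, hyM, _⟩, ⟨x, hxM, _⟩⟩ := p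
    obtain ⟨⟨y', hy', _⟩, ⟨M', hyM', _⟩, ⟨x', hxM', _⟩⟩ := p'
    obtain rfl : x = x' := congrArg Subtype.val hpp
    obtain ⟨rfl, rfl⟩ := h.proj_unique hxe' hxM hyM hy hxM' hyM' hy'
    rfl
  · rintro ⟨x, hx⟩
    have hxe : ¬ I x e := fun hxe => hx ⟨e, hP, hxe⟩
    obtain ⟨y, M, h1, h2, h3⟩ := h.exists_proj hxe
    refine ⟨⟨⟨y, h3, ?_⟩, ⟨M, h2, ?_⟩, ⟨x, h1, ?_⟩⟩, rfl⟩
    · rintro rfl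
      exact hx ⟨M, h2, h1⟩
    · rintro rfl
      exact hxe h1
    · rintro rfl
      exact hxe h3

/-- Were x off M, both y and z would be projections of x to M. -/
theorem no_triangle (h : IsGeneralizedQuadrangle I s t) {x y z : α} {L M N : β} (hxL : I x L)
    (hyL : I y L) (hyM : I y M) (hzM : I z M) (hzN : I z N) (hxN : I x N) (hLM : L ≠ M) : x = y ∨ y = z := by
  by_cases hx : I x M
  · exact .inl ((h.eq_or_eq x y L M hxL hyL hx hyM).resolve_right hLM)
  · exact .inr (h.proj_unique hx hxL hyL hyM hxN hzN hzM).1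

/-- Paths `w K x L y M` in the far geometry extending a given path `K x L y`, such that the
path `M z N w` completing it to a quadrilateral contains a point collinear with `P`. -/
theorem ncard_near_point_quadrilaterals (h : IsGeneralizedQuadrangle I s t) {P x y : α}
    {e L K : β} (hP : I P e) (hx : IsFar I P x) (hy : IsFar I P y) (hL : IsFar (flip I) e L)
    (hK : IsFar (flip I) e K) (hxL : I x L) (hxK : I x K) (hyL : I y L) (hKL : K ≠ L)
    (hyx : y ≠ x) :
    {p : α × β | (I p.1 K ∧ IsFar I P p.1 ∧ p.1 ≠ x) ∧
      (I y p.2 ∧ IsFar (flip I) e p.2 ∧ p.2 ≠ L) ∧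
      ∃ z N, I z p.2 ∧ I z N ∧ I p.1 N ∧ ¬ IsFar I P z}.ncard = t - 2 := by
  simp only [IsFar, flip, not_not] at *
  have hPK : ¬ I P K := fun hPK => hx ⟨K, hPK, hxK⟩
  -- R is the line through P meeting K, at the near point w₀. Of the t + 1 lines M through y, three
  -- are excluded: L itself, M₀ which meets e, and M₁ which meets R. For any other M, z must be the
  -- projection of P to M and w that of z to K.
  obtain ⟨w₀, R, hPR, hwR, hwK⟩ := h.exists_proj hPK
  have hye : ¬ I y e := fun hye => hy ⟨e, hP, hye⟩
  obtain ⟨y₀, M₀, hyM₀, hy₀M₀, hy₀e⟩ := h.exists_proj hye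
  have hyR : ¬ I y R := fun hyR => hy ⟨R, hPR, hyR⟩
  obtain ⟨z₁, M₁, hyM₁, hzM₁, hzR⟩ := h.exists_proj hyR
  have hyK : ¬ I y K := fun hyK => by
    rcases h.eq_or_eq x y L K hxL hyL hxK hyK with h1 | h1
    exacts [hyx h1.symm, hKL h1.symm]
  have hxR : ¬ I x R := fun hxR => hx ⟨R, hPR, hxR⟩
  have hReq : R ≠ e := by
    rintro rfl
    exact hK ⟨w₀, hwR, hwK⟩
  have h01 : M₀ ≠ M₁ := by
    rintro rfl
    have hPM : ¬ I P M₀ := fun hPM => hy ⟨M₀, hPM, hyM₀⟩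
    exact hReq (h.proj_unique hPM hPR hzR hzM₁ hP hy₀e hy₀M₀).2
  have h0L : M₀ ≠ L := by
    rintro rfl
    exact hL ⟨y₀, hy₀e, hy₀M₀⟩
  have h1L : M₁ ≠ L := by
    rintro rfl
    exact hKL (h.proj_unique hxR hxK hwK hwR hxL hzM₁ hzR).2
  have hcard : ({M | I y M} \ {M₀, L, M₁}).ncard = t - 2 := by
    rw [Set.ncard_sdiff, h.card_lines, Set.ncard_eq_three.2 ⟨M₀, L, M₁, h0L, h01, h1L.symm, rfl⟩]
    · omega
    · rintro _ (rfl | rfl | rfl) <;> assumption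
  rw [← hcard]
  refine Set.ncard_congr (fun p _ => p.2) ?_ ?_ ?_
  · rintro ⟨w, M⟩ ⟨⟨hwK', hw, hwx⟩, ⟨hyM, hM, hML⟩, z, N, hzM, hzN, hwN, Q, hPQ, hzQ⟩
    dsimp only at *
    refine ⟨hyM, ?_⟩
    rintro (rfl | rfl | rfl)
    · exact hM ⟨y₀, hy₀e, hy₀M₀⟩
    · exact hML rfl
    -- If M = M₁, then z lies on R. Projecting the far point w to R along N and along K gives N = K,
    -- which forces M = L.
    · have hPM : ¬ I P M := fun hPM => hy ⟨M, hPM, hyM⟩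
      obtain ⟨rfl, rfl⟩ := h.proj_unique hPM hPR hzR hzM₁ hPQ hzQ hzM
      have hwR' : ¬ I w R := fun hwR' => hw ⟨R, hPR, hwR'⟩
      obtain ⟨rfl, rfl⟩ := h.proj_unique hwR' hwN hzN hzR hwK' hwK hwR
      obtain ⟨-, rfl⟩ := h.proj_unique hyK hyM hzM hzN hyL hxL hxK
      exact hML rfl
  · rintro ⟨w, M⟩ ⟨w', M'⟩ ⟨⟨hwK, hw, hwx⟩, ⟨hyM, hM, hML⟩, z, N, hzM, hzN, hwN, Q, hPQ, hzQ⟩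
      ⟨⟨hwK', hw', hwx'⟩, -, z', N', hzM', hzN', hwN', Q', hPQ', hzQ'⟩ hMM
    dsimp only at *
    subst hMM
    have hPM : ¬ I P M := fun hPM => hy ⟨M, hPM, hyM⟩
    obtain ⟨rfl, rfl⟩ := h.proj_unique hPM hPQ hzQ hzM hPQ' hzQ' hzM'
    have hzK : ¬ I z K := fun hzK => hML (h.proj_unique hyK hyM hzM hzK hyL hxL hxK).2
    rw [(h.proj_unique hzK hzN hwN hwK hzN' hwN' hwK').1]
  · rintro M ⟨hyM, hM⟩
    simp only [Set.mem_insert_iff, Set.mem_singleton_iff, not_or] at hM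
    obtain ⟨hM0, hML, hM1⟩ := hM
    have hPM : ¬ I P M := fun hPM => hy ⟨M, hPM, hyM⟩
    obtain ⟨z, Q, hPQ, hzQ, hzM⟩ := h.exists_proj hPM
    have hzK : ¬ I z K := fun hzK => hML (h.proj_unique hyK hyM hzM hzK hyL hxL hxK).2
    obtain ⟨w, N, hzN, hwN, hwK'⟩ := h.exists_proj hzK
    have hxM : ¬ I x M := fun hxM => by
      rcases h.eq_or_eq x y L M hxL hyL hxM hyM with h1 | h1
      exacts [hyx h1.symm, hML h1.symm]
    refine ⟨(w, M), ⟨⟨hwK', ?_, ?_⟩, ⟨hyM, ?_, hML⟩, z, N, hzM, hzN, hwN, Q, hPQ, hzQ⟩, rfl⟩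
    -- A near w would be w₀. As M ≠ M₁, z is off R, so its projections w₀ and P to R would agree,
    -- putting P on K.
    · rintro ⟨R', hPR', hwR'⟩
      obtain ⟨rfl, rfl⟩ := h.proj_unique hPK hPR hwR hwK hPR' hwR' hwK'
      have hzR' : ¬ I z R := fun hzR' => hM1 (h.proj_unique hyR hyM hzM hzR' hyM₁ hzM₁ hzR).2
      obtain ⟨rfl, -⟩ := h.proj_unique hzR' hzN hwN hwR hzQ hPQ hPR
      exact hPK hwK
    · rintro rfl
      obtain ⟨rfl, -⟩ := h.proj_unique hxM hxL hyL hyM hwN hzN hzM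
      exact hy ⟨Q, hPQ, hzQ⟩
    · rintro ⟨u, hue, huM⟩
      exact hM0 (h.proj_unique hye hyM huM hue hyM₀ hy₀M₀ hy₀e).2

/-- The number of ways to complete a path `K x L y` in the far geometry to a quadrilateral
`w K x L y M z N` in the far geometry. -/
theorem ncard_far_quadrilaterals [Finite α] [Finite β] (h : IsGeneralizedQuadrangle I s t)
    {P x y : α}
    {e L K : β} (hP : I P e) (hx : IsFar I P x) (hy : IsFar I P y) (hL : IsFar (flip I) e L)
    (hK : IsFar (flip I) e K) (hxL : I x L) (hxK : I x K) (hyL : I y L) (hKL : K ≠ L)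
    (hyx : y ≠ x) :
    {p : α × β | (I p.1 K ∧ IsFar I P p.1 ∧ p.1 ≠ x) ∧
      (I y p.2 ∧ IsFar (flip I) e p.2 ∧ p.2 ≠ L) ∧
      ∃ z N, I z p.2 ∧ I z N ∧ I p.1 N ∧ IsFar I P z ∧ IsFar (flip I) e N}.ncard =
      (s - 1) * (t - 1) - ((t - 2) + (s - 2)) := by
  let A : Set α := {w | I w K ∧ IsFar I P w ∧ w ≠ x}
  let B : Set β := {M | I y M ∧ IsFar (flip I) e M ∧ M ≠ L}
  have hA : A.ncard = s - 1 := by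
    rw [show A = {w | I w K ∧ IsFar I P w} \ {x} by ext; simp [A, and_assoc],
      Set.ncard_sdiff_singleton_of_mem (show x ∈ {w | I w K ∧ IsFar I P w} from ⟨hxK, hx⟩), h.ncard_far_points_on hP hK]
  have hB : B.ncard = t - 1 := by
    rw [show B = {M | I y M ∧ IsFar (flip I) e M} \ {L} by ext; simp [B, and_assoc],
      Set.ncard_sdiff_singleton_of_mem (show L ∈ {M | I y M ∧ IsFar (flip I) e M} from ⟨hyL, hL⟩), h.ncard_far_lines_through hP hy]
  let B₁ : Set (α × β) := {p | (I p.1 K ∧ IsFar I P p.1 ∧ p.1 ≠ x) ∧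
      (I y p.2 ∧ IsFar (flip I) e p.2 ∧ p.2 ≠ L) ∧
      ∃ z N, I z p.2 ∧ I z N ∧ I p.1 N ∧ ¬ IsFar I P z}
  let B₂ : Set (α × β) := {p | (I p.1 K ∧ IsFar I P p.1 ∧ p.1 ≠ x) ∧
      (I y p.2 ∧ IsFar (flip I) e p.2 ∧ p.2 ≠ L) ∧
      ∃ z N, I z p.2 ∧ I z N ∧ I p.1 N ∧ ¬ IsFar (flip I) e N}
  have h₁ : B₁.ncard = t - 2 :=
    h.ncard_near_point_quadrilaterals hP hx hy hL hK hxL hxK hyL hKL hyx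
  have h₂ : B₂.ncard = s - 2 := by
    -- The path K x L y read backwards is a path of the same shape in the dual, with P and e
    -- exchanged; the pairs (w, M) get swapped.
    rw [← h.dual.ncard_near_point_quadrilaterals (P := e) (e := P) (x := L) (L := x) (y := K)
      (K := y) hP hL hK hx hy hxL hyL hxK hyx hKL,
      ← Set.ncard_image_of_injective _ (Prod.swap_injective (α := β) (β := α))]
    congr 1
    ext ⟨w, M⟩
    constructor
    · rintro ⟨h1, h2, z, N, h3, h4, h5, h6⟩
      exact ⟨(M, w), ⟨h2, h1, N, z, h5, h4, h3, h6⟩, rfl⟩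
    · rintro ⟨⟨M', w'⟩, ⟨h2, h1, N, z, h5, h4, h3, h6⟩, hsw⟩
      obtain ⟨rfl, rfl⟩ := Prod.mk.inj hsw
      exact ⟨h1, h2, z, N, h3, h4, h5, h6⟩
  have hwM {w : α} {M : β} (hwK : I w K) (hwx : w ≠ x) (hyM : I y M) (hML : M ≠ L) :
      ¬ I w M := fun hwM => by
    rcases h.no_triangle hxK hwK hwM hyM hyL hxL
      (by rintro rfl; exact (h.eq_or_eq x y L K hxL hyL hxK hyM).elim
            (fun h => hyx h.symm) fun h => hKL h.symm) with h1 | h1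
    · exact hwx h1.symm
    · subst h1
      rcases h.eq_or_eq x w K L hxK hwK hxL hyL with h1 | h1
      exacts [hwx h1.symm, hKL h1]
  have hdisj : Disjoint B₁ B₂ := by
    rw [Set.disjoint_left]
    rintro ⟨w, M⟩ ⟨⟨hwK, hw, hwx⟩, ⟨hyM, hM, hML⟩, z, N, hzM, hzN, hwN, hz⟩
      ⟨-, -, z', N', hzM', hzN', hwN', hN⟩
    dsimp only at *
    obtain ⟨rfl, rfl⟩ := h.proj_unique (hwM hwK hwx hyM hML) hwN hzN hzM hwN' hzN' hzM'
    simp only [IsFar, flip, not_not] at *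
    obtain ⟨Q, hPQ, hzQ⟩ := hz
    obtain ⟨u, hue, huN⟩ := hN
    have hze : ¬ I z e := fun hze => hM ⟨z, hze, hzM⟩
    -- Both N and the line Q from z to P meet e, so N = Q passes through P and w would be near.
    obtain ⟨-, rfl⟩ := h.proj_unique hze hzN huN hue hzQ hPQ hP
    exact hw ⟨N, hPQ, hwN⟩
  have hsub : B₁ ∪ B₂ ⊆ A ×ˢ B := by
    rintro p (⟨h1, h2, -⟩ | ⟨h1, h2, -⟩) <;> exact ⟨h1, h2⟩
  rw [← hA, ← hB, ← h₁, ← h₂, ← Set.ncard_union_eq hdisj, ← Set.ncard_prod,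
    ← Set.ncard_sdiff hsub]
  congr 1
  ext ⟨w, M⟩
  constructor
  · rintro ⟨h1, h2, z, N, hzM, hzN, hwN, hz, hN⟩
    have hw := hwM h1.1 h1.2.2 h2.1 h2.2.2
    refine ⟨⟨h1, h2⟩, ?_⟩
    rintro (⟨-, -, z', N', hzM', hzN', hwN', hn⟩ | ⟨-, -, z', N', hzM', hzN', hwN', hn⟩) <;>
    obtain ⟨rfl, rfl⟩ := h.proj_unique hw hwN hzN hzM hwN' hzN' hzM'
    exacts [hn hz, hn hN]
  · rintro ⟨⟨h1, h2⟩, h3⟩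
    obtain ⟨z, N, hwN, hzN, hzM⟩ := h.exists_proj (hwM h1.1 h1.2.2 h2.1 h2.2.2)
    refine ⟨h1, h2, z, N, hzM, hzN, hwN, ?_, ?_⟩ <;> by_contra hn
    · exact h3 (.inl ⟨h1, h2, z, N, hzM, hzN, hwN, hn⟩)
    · exact h3 (.inr ⟨h1, h2, z, N, hzM, hzN, hwN, hn⟩)

end IsGeneralizedQuadrangle

/-! ### Cycles through an edge as paths. -/

namespace SimpleGraph.Walk

variable {V : Type*} {G : SimpleGraph V} {a b : V}

lemma IsPath.isCycle_cons {p : G.Walk b a} (hp : p.IsPath) (hl : 2 ≤ p.length)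
    (hab : G.Adj a b) : (cons hab p).IsCycle := by
  rw [isCycle_iff_isPath_tail_and_le_length]
  constructor
  · simpa using hp
  · rw [length_cons]; omega

/-- Each vertex has exactly two neighbours on the cycle, so a base point and a first step determine
the whole traversal. -/
lemma IsCycle.eq_of_toSubgraph_eq {c d : G.Walk a a} (hc : c.IsCycle) (hd : d.IsCycle)
    (hl : c.length = d.length) (hs : c.snd = d.snd) (h : c.toSubgraph = d.toSubgraph) : c = d := by
  refine ext_getVert_le_length hl fun k hk => ?_
  have key : ∀ k, k + 1 ≤ c.length →
      c.getVert k = d.getVert k ∧ c.getVert (k + 1) = d.getVert (k + 1) := by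
    intro k
    induction k with
    | zero => exact fun _ => ⟨by simp, hs⟩
    | succ k ih =>
      intro hk
      obtain ⟨h1, h2⟩ := ih (by omega)
      refine ⟨h2, ?_⟩
      have hc' := hc.neighborSet_toSubgraph_internal (i := k + 1) (by omega) (by omega)
      have hd' := hd.neighborSet_toSubgraph_internal (i := k + 1) (by omega) (by omega)
      rw [h, h2, hd'] at hc'
      simp only [Nat.add_sub_cancel] at hc'
      have hmem : d.getVert (k + 1 + 1) ∈ ({c.getVert k, c.getVert (k + 1 + 1)} : Set V) := by
        rw [← hc']; simp
      rcases hmem with h3 | h3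
      · have := hd.getVert_sub_one_ne_getVert_add_one (i := k + 1) (by omega)
        rw [Nat.add_sub_cancel, ← h1] at this
        exact absurd h3.symm this
      · exact h3.symm
  rcases k with _ | k
  · simp
  · exact (key k hk).2

end SimpleGraph.Walk

open SimpleGraph in
/-- Cycles through an edge `ab` correspond to paths from `b` to `a`. -/
theorem ncard_cycles_through_edge {V : Type*} {G : SimpleGraph V} {a b : V} (hab : G.Adj a b)
    {n : ℕ} (hn : 2 ≤ n) :
    {H : G.Subgraph | IsCycleSubgraph G (n + 1) H ∧ s(a, b) ∈ H.edgeSet}.ncard =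
      Nat.card {p : G.Walk b a // p.IsPath ∧ p.length = n} := by
  classical
  symm
  refine Nat.card_eq_of_bijective (fun p => ⟨(Walk.cons hab p.1).toSubgraph,
    ⟨a, .cons hab p.1, p.2.1.isCycle_cons (by omega) hab, by simp [p.2.2], rfl⟩, by simp⟩)
    ⟨?_, ?_⟩
  · rintro ⟨p, hp, hpl⟩ ⟨p', hp', hpl'⟩ h
    have h' : (Walk.cons hab p).toSubgraph = (Walk.cons hab p').toSubgraph :=
      congrArg Subtype.val h
    have := (hp.isCycle_cons (by omega) hab).eq_of_toSubgraph_eq (hp'.isCycle_cons (by omega) hab)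
      (by simp [hpl, hpl']) (by simp) h'
    simpa using this
  · rintro ⟨H, ⟨v, c, hc, hcl, rfl⟩, he⟩
    rw [Walk.mem_edges_toSubgraph] at he
    have ha := c.fst_mem_support_of_mem_edges he
    have key : ∀ d : G.Walk a a, d.IsCycle → d.length = n + 1 → d.snd = b →
        ∃ p : G.Walk b a, (p.IsPath ∧ p.length = n) ∧
          (Walk.cons hab p).toSubgraph = d.toSubgraph := by
      intro d hd hdl hdb
      cases d with
      | nil => simp at hdl
      | cons h p =>
        obtain rfl : _ = b := by simpa using hdb
        exact ⟨p, ⟨((Walk.cons_isCycle_iff p h).1 hd).1, by simpa using hdl⟩, rfl⟩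
    have hd := hc.rotate ha
    have hadj : (c.rotate a ha).toSubgraph.Adj a b := by
      rw [← Subgraph.mem_edgeSet, Walk.toSubgraph_rotate, Walk.mem_edges_toSubgraph]
      exact he
    have hmem : b ∈ (c.rotate a ha).toSubgraph.neighborSet a := hadj
    -- Rotated to start at a, the cycle has b second or next to last; in the latter case it is
    -- reversed.
    rw [hd.neighborSet_toSubgraph_endpoint] at hmem
    rcases hmem with h | h
    · obtain ⟨p, hp, hpe⟩ := key _ hd (by simpa using hcl) h.symm
      exact ⟨⟨p, hp⟩, Subtype.ext (hpe.trans (c.toSubgraph_rotate ha))⟩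
    · obtain ⟨p, hp, hpe⟩ := key _ hd.reverse (by simpa using hcl) (by simpa using h.symm)
      exact ⟨⟨p, hp⟩, Subtype.ext
        (hpe.trans ((Walk.toSubgraph_reverse _).trans (c.toSubgraph_rotate ha)))⟩

/-! ### Walks, girth and neighbourhoods in incidence graphs. -/

section Incidence

open SimpleGraph

variable {α β : Type*} {I : α → β → Prop}

@[simp] lemma incidenceGraph_adj_inl_inr {x : α} {L : β} :
    (incidenceGraph I).Adj (.inl x) (.inr L) ↔ I x L := Iff.rfl

@[simp] lemma incidenceGraph_adj_inr_inl {x : α} {L : β} :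
    (incidenceGraph I).Adj (.inr L) (.inl x) ↔ I x L := Iff.rfl

lemma exists_eq_cons_of_inl {x : α} {v : α ⊕ β} {n : ℕ}
    (p : (incidenceGraph I).Walk (.inl x) v) (hp : p.length = n + 1) :
    ∃ (L : β) (h : (incidenceGraph I).Adj (.inl x) (.inr L))
      (p' : (incidenceGraph I).Walk (.inr L) v), p = .cons h p' ∧ p'.length = n := by
  cases p with
  | nil => simp at hp
  | @cons _ w _ h p' =>
    rcases w with y | L
    · exact h.elim
    · exact ⟨L, h, p', rfl, by simpa using hp⟩

lemma exists_eq_cons_of_inr {L : β} {v : α ⊕ β} {n : ℕ}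
    (p : (incidenceGraph I).Walk (.inr L) v) (hp : p.length = n + 1) :
    ∃ (x : α) (h : (incidenceGraph I).Adj (.inr L) (.inl x))
      (p' : (incidenceGraph I).Walk (.inl x) v), p = .cons h p' ∧ p'.length = n := by
  cases p with
  | nil => simp at hp
  | @cons _ w _ h p' =>
    rcases w with y | L
    · exact ⟨y, h, p', rfl, by simpa using hp⟩
    · exact h.elim

/-- The walk of length seven in an incidence graph with the given vertices. -/
def quadrilateralWalk {x y z w : α} {L M N K : β} (h₁ : I y L) (h₂ : I y M) (h₃ : I z M)
    (h₄ : I z N) (h₅ : I w N) (h₆ : I w K) (h₇ : I x K) :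
    (incidenceGraph I).Walk (.inr L) (.inl x) :=
  .cons (v := .inl y) (incidenceGraph_adj_inr_inl.2 h₁) <|
  .cons (v := .inr M) (incidenceGraph_adj_inl_inr.2 h₂) <|
  .cons (v := .inl z) (incidenceGraph_adj_inr_inl.2 h₃) <|
  .cons (v := .inr N) (incidenceGraph_adj_inl_inr.2 h₄) <|
  .cons (v := .inl w) (incidenceGraph_adj_inr_inl.2 h₅) <|
  .cons (v := .inr K) (incidenceGraph_adj_inl_inr.2 h₆) <|
  .cons (v := .inl x) (incidenceGraph_adj_inr_inl.2 h₇) .nil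

lemma support_quadrilateralWalk {x y z w : α} {L M N K : β} (h₁ : I y L) (h₂ : I y M)
    (h₃ : I z M) (h₄ : I z N) (h₅ : I w N) (h₆ : I w K) (h₇ : I x K) :
    (quadrilateralWalk h₁ h₂ h₃ h₄ h₅ h₆ h₇).support =
      [.inr L, .inl y, .inr M, .inl z, .inr N, .inl w, .inr K, .inl x] := rfl

lemma isPath_quadrilateralWalk_iff {x y z w : α} {L M N K : β} (h₁ : I y L) (h₂ : I y M)
    (h₃ : I z M) (h₄ : I z N) (h₅ : I w N) (h₆ : I w K) (h₇ : I x K) :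
    (quadrilateralWalk h₁ h₂ h₃ h₄ h₅ h₆ h₇).IsPath ↔ [y, z, w, x].Nodup ∧ [L, M, N, K].Nodup := by
  rw [Walk.isPath_def, support_quadrilateralWalk]
  simp only [List.nodup_cons, List.mem_cons, List.not_mem_nil, reduceCtorEq, Sum.inl.injEq,
    Sum.inr.injEq, or_false, false_or, not_or, not_false_eq_true, List.nodup_nil, and_true]
  tauto

lemma exists_eq_quadrilateralWalk {x : α} {L : β} (p : (incidenceGraph I).Walk (.inr L) (.inl x))
    (hp : p.length = 7) : ∃ (y z w : α) (M N K : β) (h₁ : I y L) (h₂ : I y M) (h₃ : I z M)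
      (h₄ : I z N) (h₅ : I w N) (h₆ : I w K) (h₇ : I x K),
      p = quadrilateralWalk h₁ h₂ h₃ h₄ h₅ h₆ h₇ := by
  obtain ⟨y, h1, p, rfl, hl1⟩ := exists_eq_cons_of_inr (n := 6) p hp
  obtain ⟨M, h2, p, rfl, hl2⟩ := exists_eq_cons_of_inl (n := 5) p hl1
  obtain ⟨z, h3, p, rfl, hl3⟩ := exists_eq_cons_of_inr (n := 4) p hl2
  obtain ⟨N, h4, p, rfl, hl4⟩ := exists_eq_cons_of_inl (n := 3) p hl3
  obtain ⟨w, h5, p, rfl, hl5⟩ := exists_eq_cons_of_inr (n := 2) p hl4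
  obtain ⟨K, h6, p, rfl, hl6⟩ := exists_eq_cons_of_inl (n := 1) p hl5
  obtain ⟨x', h7, p, rfl, hl7⟩ := exists_eq_cons_of_inr (n := 0) p hl6
  obtain rfl : x' = x := by simpa using Walk.eq_of_length_eq_zero hl7
  obtain rfl : p = .nil := (Walk.length_eq_zero_iff.1 hl7).eq_nil
  exact ⟨y, z, w, M, N, K, h1, h2, h3, h4, h5, h6, h7, rfl⟩

/-- An incidence graph without digons and triangles has girth at least eight. -/
theorem eight_le_egirth_incidenceGraph
    (h₂ : ∀ (x y : α) (L M : β), I x L → I y L → I x M → I y M → x = y ∨ L = M)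
    (h₃ : ∀ (x y z : α) (L M N : β), I x L → I y L → I y M → I z M → I z N → I x N →
      L ≠ M → x = y ∨ y = z) : 8 ≤ (incidenceGraph I).egirth := by
  classical
  have key : ∀ (x : α) (c : (incidenceGraph I).Walk (.inl x) (.inl x)), c.IsCycle →
      8 ≤ c.length := by
    intro x c hc
    by_contra! hlt
    have hge := hc.three_le_length
    obtain ⟨n, hn⟩ : ∃ n, n = c.length := ⟨_, rfl⟩
    rw [← hn] at hlt hge
    obtain ⟨L, h1, p1, rfl, hp1⟩ := exists_eq_cons_of_inl (n := n - 1) c (by omega)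
    have hpath := ((Walk.cons_isCycle_iff _ _).1 hc).1
    obtain ⟨y, g1, p2, rfl, hp2⟩ := exists_eq_cons_of_inr (n := n - 2) p1 (by omega)
    obtain ⟨M, g2, p3, rfl, hp3⟩ := exists_eq_cons_of_inl (n := n - 3) p2 (by omega)
    -- Odd lengths would end at a line instead of the point x; length 4 is a digon and length 6 a
    -- triangle.
    obtain h0 | h0 := Nat.eq_zero_or_pos (n - 3)
    · exact absurd (Walk.eq_of_length_eq_zero (hp3.trans h0)) (by simp)
    obtain ⟨z, g3, p4, rfl, hp4⟩ := exists_eq_cons_of_inr (n := n - 4) p3 (by omega)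
    have hLM : L ≠ M := by
      rintro rfl
      simp at hpath
    have hyz : y ≠ z := by
      rintro rfl
      simp at hpath
    have hyx : y ≠ x := by
      rintro rfl
      simp at hpath
    obtain h0 | h0 := Nat.eq_zero_or_pos (n - 4)
    · obtain rfl : z = x := by simpa using Walk.eq_of_length_eq_zero (hp4.trans h0)
      rcases h₂ y z L M g1 h1 g2 g3 with h | h
      exacts [hyx h, hLM h]
    obtain ⟨N, g4, p5, rfl, hp5⟩ := exists_eq_cons_of_inl (n := n - 5) p4 (by omega)
    obtain h0 | h0 := Nat.eq_zero_or_pos (n - 5)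
    · exact absurd (Walk.eq_of_length_eq_zero (hp5.trans h0)) (by simp)
    obtain ⟨w, g5, p6, rfl, hp6⟩ := exists_eq_cons_of_inr (n := n - 6) p5 (by omega)
    obtain h0 | h0 := Nat.eq_zero_or_pos (n - 6)
    · obtain rfl : w = x := by simpa using Walk.eq_of_length_eq_zero (hp6.trans h0)
      rcases h₃ w y z L M N h1 g1 g2 g3 g4 g5 hLM with h | h
      exacts [hyx h.symm, hyz h]
    obtain ⟨K, g6, p7, rfl, hp7⟩ := exists_eq_cons_of_inl (n := n - 7) p6 (by omega)
    exact absurd (Walk.eq_of_length_eq_zero (hp7.trans (by omega))) (by simp)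
  rw [le_egirth]
  rintro (x | L) c hc
  · exact_mod_cast key x c hc
  · have hge := hc.three_le_length
    obtain ⟨y, h, p, rfl, hp⟩ := exists_eq_cons_of_inr (n := c.length - 1) c (by omega)
    have hy : Sum.inl y ∈ (Walk.cons h p).support := by simp
    have := key y _ (hc.rotate hy)
    rw [Walk.length_rotate] at this
    exact_mod_cast this

lemma neighborSet_incidenceGraph_inl (x : α) :
    (incidenceGraph I).neighborSet (.inl x) = Sum.inr '' {L | I x L} := by
  ext (y | L)
  · simp only [mem_neighborSet, Set.mem_image, reduceCtorEq, and_false, exists_false, iff_false]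
    exact id
  · simp

lemma neighborSet_incidenceGraph_inr (L : β) :
    (incidenceGraph I).neighborSet (.inr L) = Sum.inl '' {x | I x L} := by
  ext (y | M)
  · simp
  · simp only [mem_neighborSet, Set.mem_image, reduceCtorEq, and_false, exists_false, iff_false]
    exact id

end Incidence

lemma ncard_setOf_subtype {α : Type*} (p r : α → Prop) :
    {x : {x // p x} | r x.1}.ncard = {x | r x ∧ p x}.ncard := by
  rw [← Set.ncard_image_of_injective _ Subtype.val_injective]
  congr 1
  ext x
  constructor
  · rintro ⟨y, hy, rfl⟩
    exact ⟨hy, y.2⟩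
  · rintro ⟨h1, h2⟩
    exact ⟨⟨x, h2⟩, h1, rfl⟩

/-! ### Edge-girth-regularity of the deleted incidence graph. -/

namespace IsGeneralizedQuadrangle

open SimpleGraph

variable {α β : Type*} {I : α → β → Prop} {s t : ℕ}

theorem ncard_neighborSet_deletedIncidenceGraph_inl (h : IsGeneralizedQuadrangle I s t) {P : α}
    {e : β} (hP : I P e) (x) :
    ((deletedIncidenceGraph I P e).neighborSet (.inl x)).ncard = t := by
  rw [deletedIncidenceGraph, neighborSet_incidenceGraph_inl,
    Set.ncard_image_of_injective _ Sum.inr_injective, ncard_setOf_subtype _ (I x.1)]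
  exact h.ncard_far_lines_through hP x.2

theorem ncard_neighborSet_deletedIncidenceGraph_inr (h : IsGeneralizedQuadrangle I s t) {P : α}
    {e : β} (hP : I P e) (L) :
    ((deletedIncidenceGraph I P e).neighborSet (.inr L)).ncard = s := by
  rw [deletedIncidenceGraph, neighborSet_incidenceGraph_inr,
    Set.ncard_image_of_injective _ Sum.inl_injective, ncard_setOf_subtype _ (I · L.1)]
  exact h.ncard_far_points_on hP L.2

theorem eight_le_egirth_deletedIncidenceGraph (h : IsGeneralizedQuadrangle I s t) (P : α) (e : β) :
    8 ≤ (deletedIncidenceGraph I P e).egirth := by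
  apply eight_le_egirth_incidenceGraph
  · intro x y L M h1 h2 h3 h4
    simpa only [Subtype.ext_iff] using h.eq_or_eq x.1 y.1 L.1 M.1 h1 h2 h3 h4
  · intro x y z L M N h1 h2 h3 h4 h5 h6 h7
    simp only [ne_eq, Subtype.ext_iff] at h7 ⊢
    exact h.no_triangle h1 h2 h3 h4 h5 h6 h7

/-- Any further coincidence would create a digon or triangle, so four inequalities around the path K
x L y suffice for a genuine 8-cycle. -/
theorem quadrilateral_distinct (h : IsGeneralizedQuadrangle I s t) {x y z w : α} {L M N K : β}
    (hxL : I x L) (hyL : I y L) (hyM : I y M) (hzM : I z M) (hzN : I z N) (hwN : I w N)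
    (hwK : I w K) (hxK : I x K) (hKL : K ≠ L) (hyx : y ≠ x) (hML : M ≠ L) (hwx : w ≠ x) :
    ¬ I w M ∧ [y, z, w, x].Nodup ∧ [L, M, N, K].Nodup := by
  have hwL : ¬ I w L := fun hwL => by
    rcases h.eq_or_eq x w K L hxK hwK hxL hwL with h1 | h1
    exacts [hwx h1.symm, hKL h1]
  have hxM : ¬ I x M := fun hxM => by
    rcases h.eq_or_eq x y L M hxL hyL hxM hyM with h1 | h1
    exacts [hyx h1.symm, hML h1.symm]
  have hyK : ¬ I y K := fun hyK => by
    rcases h.eq_or_eq x y L K hxL hyL hxK hyK with h1 | h1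
    exacts [hyx h1.symm, hKL h1.symm]
  have hwM : ¬ I w M := fun hwM => hwL ((h.proj_unique hxM hxK hwK hwM hxL hyL hyM).1 ▸ hyL)
  have hyz : y ≠ z := by
    rintro rfl
    exact hyx (h.proj_unique hwL hwN hzN hyL hwK hxK hxL).1
  have hNK : N ≠ K := by
    rintro rfl
    exact hML (h.proj_unique hyK hyM hzM hzN hyL hxL hxK).2
  refine ⟨hwM, ?_, ?_⟩
  · simp only [List.nodup_cons, List.mem_cons, List.not_mem_nil, or_false, not_or, not_false_eq_true,
      List.nodup_nil, and_true]
    refine ⟨⟨hyz, ?_, hyx⟩, ⟨?_, ?_⟩, hwx⟩ <;> rintro rfl <;> contradiction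
  · simp only [List.nodup_cons, List.mem_cons, List.not_mem_nil, or_false, not_or, not_false_eq_true,
      List.nodup_nil, and_true]
    refine ⟨⟨hML.symm, ?_, hKL.symm⟩, ⟨?_, ?_⟩, hNK⟩ <;> rintro rfl <;> contradiction

/-- A path is encoded by K, y and the pair (w, M); z and N are then forced. -/
theorem card_paths_deletedIncidenceGraph [Finite α] [Finite β]
    (h : IsGeneralizedQuadrangle I s t) {P : α} {e : β} (hP : I P e)
    (x : {x // ¬ ∃ L, I P L ∧ I x L}) (L : {M // ¬ ∃ y, I y e ∧ I y M}) (hxL : I x.1 L.1) :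
    Nat.card {p : (deletedIncidenceGraph I P e).Walk (.inr L) (.inl x) //
      p.IsPath ∧ p.length = 7} =
      (t - 1) * ((s - 1) * ((s - 1) * (t - 1) - ((t - 2) + (s - 2)))) := by
  classical
  let A := {K // (I x.1 K ∧ IsFar (flip I) e K) ∧ K ≠ L.1}
  let B := {y // (I y L.1 ∧ IsFar I P y) ∧ y ≠ x.1}
  let C (K : A) (y : B) := {p : α × β // (I p.1 K.1 ∧ IsFar I P p.1 ∧ p.1 ≠ x.1) ∧
    (I y.1 p.2 ∧ IsFar (flip I) e p.2 ∧ p.2 ≠ L.1) ∧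
      ∃ z N, I z p.2 ∧ I z N ∧ I p.1 N ∧ IsFar I P z ∧ IsFar (flip I) e N}
  have hA : Nat.card A = t - 1 := by
    rw [← h.ncard_far_lines_through hP x.2,
      ← Set.ncard_sdiff_singleton_of_mem
        (show L.1 ∈ {M | I x.1 M ∧ IsFar (flip I) e M} from ⟨hxL, L.2⟩)]
    rfl
  have hB : Nat.card B = s - 1 := by
    rw [← h.ncard_far_points_on hP L.2,
      ← Set.ncard_sdiff_singleton_of_mem
        (show x.1 ∈ {y | I y L.1 ∧ IsFar I P y} from ⟨hxL, x.2⟩)]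
    rfl
  have hC (K : A) (y : B) : Nat.card (C K y) = (s - 1) * (t - 1) - ((t - 2) + (s - 2)) :=
    h.ncard_far_quadrilaterals hP x.2 y.2.1.2 L.2 K.2.1.2 hxL K.2.1.1 y.2.1.1 K.2.2 y.2.2
  have key : Nat.card (Σ K : A, Σ y : B, C K y) =
      (t - 1) * ((s - 1) * ((s - 1) * (t - 1) - ((t - 2) + (s - 2)))) := by
    have := Fintype.ofFinite A
    have := Fintype.ofFinite B
    simp only [Nat.card_sigma, hC, Finset.sum_const, Finset.card_univ, smul_eq_mul,
      ← Nat.card_eq_fintype_card, hA, hB]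
  rw [← key]
  symm
  choose z N hzM hzN hwN hz hN using fun (K : A) (y : B) (p : C K y) => p.2.2.2
  let f (σ : Σ K : A, Σ y : B, C K y) :
      (deletedIncidenceGraph I P e).Walk (.inr L) (.inl x) :=
    quadrilateralWalk (y := ⟨σ.2.1.1, σ.2.1.2.1.2⟩) (M := ⟨σ.2.2.1.2, σ.2.2.2.2.1.2.1⟩)
      (z := ⟨z _ _ σ.2.2, hz _ _ σ.2.2⟩) (N := ⟨N _ _ σ.2.2, hN _ _ σ.2.2⟩)
      (w := ⟨σ.2.2.1.1, σ.2.2.2.1.2.1⟩) (K := ⟨σ.1.1, σ.1.2.1.2⟩)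
      σ.2.1.2.1.1 σ.2.2.2.2.1.1 (hzM _ _ σ.2.2) (hzN _ _ σ.2.2) (hwN _ _ σ.2.2)
      σ.2.2.2.1.1 σ.1.2.1.1
  refine Nat.card_eq_of_bijective (fun σ => ⟨f σ, ?_, rfl⟩) ⟨?_, ?_⟩
  · obtain ⟨-, h1, h2⟩ := h.quadrilateral_distinct hxL σ.2.1.2.1.1 σ.2.2.2.2.1.1
      (hzM _ _ σ.2.2) (hzN _ _ σ.2.2) (hwN _ _ σ.2.2) σ.2.2.2.1.1 σ.1.2.1.1
      σ.1.2.2 σ.2.1.2.2 σ.2.2.2.2.1.2.2 σ.2.2.2.1.2.2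
    exact (isPath_quadrilateralWalk_iff _ _ _ _ _ _ _).2
      ⟨List.Nodup.of_map Subtype.val h1, List.Nodup.of_map Subtype.val h2⟩
  · rintro ⟨K, y, p⟩ ⟨K', y', p'⟩ hff
    have hs := congrArg Walk.support (congrArg Subtype.val hff)
    simp only [f] at hs
    erw [support_quadrilateralWalk, support_quadrilateralWalk] at hs
    simp only [List.cons.injEq, Sum.inl.injEq, Sum.inr.injEq, and_true, true_and] at hs
    obtain ⟨hy, hM, -, -, hw, hK⟩ := hs
    obtain rfl : K = K' := Subtype.ext (Subtype.mk.inj hK)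
    obtain rfl : y = y' := Subtype.ext (Subtype.mk.inj hy)
    obtain rfl : p = p' :=
      Subtype.ext (Prod.ext (Subtype.mk.inj hw) (Subtype.mk.inj hM))
    rfl
  · rintro ⟨p, hp, hlen⟩
    obtain ⟨y, z', w, M, N', K, h1, h2, h3, h4, h5, h6, h7, rfl⟩ :=
      exists_eq_quadrilateralWalk p hlen
    have hnd := (isPath_quadrilateralWalk_iff (I := fun (x : {x // ¬ ∃ L, I P L ∧ I x L})
      (M : {M // ¬ ∃ y, I y e ∧ I y M}) => I x.1 M.1) h1 h2 h3 h4 h5 h6 h7).1 hp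
    simp only [List.nodup_cons, List.mem_cons, List.not_mem_nil, or_false, not_or,
      not_false_eq_true, List.nodup_nil, and_true, Subtype.ext_iff] at hnd
    obtain ⟨⟨⟨-, -, hyx⟩, -, hwx⟩, ⟨hLM, -, hLK⟩, -⟩ := hnd
    let k : A := ⟨K.1, ⟨h7, K.2⟩, Ne.symm hLK⟩
    let y₁ : B := ⟨y.1, ⟨h1, y.2⟩, hyx⟩
    let c : C k y₁ := ⟨(w.1, M.1), ⟨h6, w.2, hwx⟩, ⟨h2, M.2, Ne.symm hLM⟩,
      z'.1, N'.1, h3, h4, h5, z'.2, N'.2⟩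
    have hwM := (h.quadrilateral_distinct hxL h1 h2 h3 h4 h5 h6 h7 (Ne.symm hLK) hyx
      (Ne.symm hLM) hwx).1
    -- The chosen z and N need not be those of the given path by definition; uniqueness of the
    -- projection of w to M identifies them.
    obtain ⟨e1, e2⟩ := h.proj_unique hwM (hwN k y₁ c) (hzN k y₁ c) (hzM k y₁ c) h5 h4 h3
    have e1' : (⟨z k y₁ c, hz k y₁ c⟩ : {x // ¬ ∃ L, I P L ∧ I x L}) = z' := Subtype.ext e1
    have e2' : (⟨N k y₁ c, hN k y₁ c⟩ : {M // ¬ ∃ y, I y e ∧ I y M}) = N' := Subtype.ext e2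
    exact ⟨⟨k, y₁, c⟩, Subtype.ext (Walk.support_injective (congrArg₂
      (fun a b => [Sum.inr L, Sum.inl y, Sum.inr M, Sum.inl a, Sum.inr b, Sum.inl w, Sum.inr K,
        Sum.inl x]) e1' e2'))⟩

/-- Deleting a flag from a generalized quadrangle of order `(q, q)` gives an
edge-girth-regular graph. -/
theorem isEdgeGirthRegular_deletedIncidenceGraph [Finite α] [Finite β] {q : ℕ} (hq : 2 ≤ q)
    (h : IsGeneralizedQuadrangle I q q) {P : α} {e : β} (hP : I P e) :
    IsEdgeGirthRegular (deletedIncidenceGraph I P e) (2 * q ^ 3) q 8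
      ((q - 1) ^ 2 * ((q - 2) ^ 2 + 1)) := by
  have harith : (q - 1) * ((q - 1) * ((q - 1) * (q - 1) - ((q - 2) + (q - 2)))) =
      (q - 1) ^ 2 * ((q - 2) ^ 2 + 1) := by
    -- With q = r + 2 the truncated subtractions are exact: (r + 1)² - 2r = r² + 1.
    obtain ⟨r, rfl⟩ := Nat.exists_eq_add_of_le' hq
    have : (r + 2 - 1) * (r + 2 - 1) - ((r + 2 - 2) + (r + 2 - 2)) = (r + 2 - 2) ^ 2 + 1 := by
      simp only [Nat.add_sub_cancel, show r + 2 - 1 = r + 1 from rfl]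
      rw [show (r + 1) * (r + 1) = r ^ 2 + 1 + (r + r) by ring, Nat.add_sub_cancel]
    rw [this]
    ring
  have hpoints : Nat.card {x // ¬ ∃ L, I P L ∧ I x L} = q * (q * q) := h.card_far hP
  have hlines : Nat.card {M // ¬ ∃ y, I y e ∧ I y M} = q * (q * q) := h.dual.card_far hP
  have hpaths x L (hxL : (deletedIncidenceGraph I P e).Adj (.inl x) (.inr L)) :=
    (h.card_paths_deletedIncidenceGraph hP x L hxL).trans harith
  refine ⟨inferInstance, ?_, ?_, le_antisymm ?_ (h.eight_le_egirth_deletedIncidenceGraph P e), ?_⟩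
  · rw [Nat.card_sum, hpoints, hlines]
    ring
  · rintro (x | L)
    · exact h.ncard_neighborSet_deletedIncidenceGraph_inl hP x
    · exact h.ncard_neighborSet_deletedIncidenceGraph_inr hP L
  · obtain ⟨x⟩ : Nonempty {x // ¬ ∃ L, I P L ∧ I x L} :=
      (Nat.card_pos_iff.1 (by rw [hpoints]; positivity)).1
    obtain ⟨v, hv⟩ := Set.nonempty_of_ncard_ne_zero
      (by rw [h.ncard_neighborSet_deletedIncidenceGraph_inl hP x]; omega :
        ((deletedIncidenceGraph I P e).neighborSet (.inl x)).ncard ≠ 0)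
    rcases v with y | L
    · exact hv.elim
    -- The path count is positive for q ≥ 2, so some 8-cycle exists and the girth bound is attained.
    · have hpos : 0 < (q - 1) ^ 2 * ((q - 2) ^ 2 + 1) :=
        Nat.mul_pos (pow_pos (by omega) 2) (Nat.succ_pos _)
      rw [← hpaths x L hv] at hpos
      obtain ⟨p, hp, hpl⟩ := (Nat.card_pos_iff.1 hpos).1
      have := egirth_le_length (hp.isCycle_cons (by omega) hv)
      exact this.trans_eq (congrArg (fun n : ℕ => ((n + 1 : ℕ) : ℕ∞)) hpl)
  · intro ε hε
    induction ε using Sym2.ind with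
    | _ a b =>
      rw [mem_edgeSet] at hε
      rcases a with x | L <;> rcases b with y | M
      · exact hε.elim
      · rw [ncard_cycles_through_edge hε (n := 7) (by norm_num), hpaths _ _ hε]
      · rw [Sym2.eq_swap, ncard_cycles_through_edge hε.symm (n := 7) (by norm_num),
          hpaths _ _ hε.symm]
      · exact hε.elim

end IsGeneralizedQuadrangle

theorem mainTheorem12 (q : ℕ) (hq : IsPrimePow q) :
    -- a generalized quadrangle of order `(q, q)` exists
    (∃ (α β : Type) (I : α → β → Prop), IsGeneralizedQuadrangle I q q) ∧
    -- an `egr(2q³, q, 8, (q - 1)²((q - 2)² + 1))` graph exists (note that `2 ≤ q`)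
    (∃ (V : Type) (G : SimpleGraph V),
      IsEdgeGirthRegular G (2 * q ^ 3) q 8 ((q - 1) ^ 2 * ((q - 2) ^ 2 + 1))) ∧
    -- namely, the one constructed from the symplectic quadrangle `W(q)` and any of its flags
    (∀ (F : Type*) [Field F], Nat.card F = q →
      IsGeneralizedQuadrangle (symplecticIncidence F) q q ∧
      ∀ (P : Projectivization F (Fin 4 → F)) (e : SymplecticLine F), symplecticIncidence F P e →
        IsEdgeGirthRegular (deletedIncidenceGraph (symplecticIncidence F) P e)
          (2 * q ^ 3) q 8 ((q - 1) ^ 2 * ((q - 2) ^ 2 + 1))) := by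
  have hq2 : 2 ≤ q := hq.two_le
  obtain ⟨F, _, hF⟩ : ∃ (F : Type) (_ : Field F), Nat.card F = q := by
    obtain ⟨p, k, hp, hk, rfl⟩ := hq
    have := Fact.mk hp.nat_prime
    exact ⟨GaloisField p k, inferInstance, GaloisField.card p k hk.ne'⟩
  have : Finite F := Nat.finite_of_card_ne_zero (by omega)
  have hGQ := isGeneralizedQuadrangle_symplecticIncidence F
  rw [hF] at hGQ
  refine ⟨⟨_, _, _, hGQ⟩, ?_, ?_⟩
  · obtain ⟨P⟩ := hGQ.nonempty_points
    obtain ⟨e, he⟩ := Set.nonempty_of_ncard_ne_zero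
      (by rw [hGQ.card_lines P]; omega :
        {L : SymplecticLine F | symplecticIncidence F P L}.ncard ≠ 0)
    exact ⟨_, _, hGQ.isEdgeGirthRegular_deletedIncidenceGraph hq2 he⟩
  · intro F' _ hF'
    have : Finite F' := Nat.finite_of_card_ne_zero (by omega)
    have h := isGeneralizedQuadrangle_symplecticIncidence F'
    rw [hF'] at h
    exact ⟨h, fun P e he => h.isEdgeGirthRegular_deletedIncidenceGraph hq2 he⟩
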